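/- Let $p\ge 3$ be a prime, let $k$ be an algebraically closed field of characteristic $p$, and let $1\le n\le p-1$. Write $\wp(a)=a^p-a$, and put $S(X)=\wp(X)=X^p-X$, $Q(X)=\wp(S(X))$ in $k[X]$, and $V=\{y\in k : Q(y)=0\}$, a subgroup of $(k,+)$. For $1\le i\le p-2$ let $g_i=\frac{S(X)^{i+1}}{(i+1)!}\in k[X]$, and let $g_{p-1}\in k[X]$ be the reduction mod $p$ of the polynomial $\frac1{p!}\big((X^p-X)^p-X^{p^2}+X^p\big)\in W(k)[X]$, where $W(k)$ is the ring of Witt vectors of $k$. Let $f_i=\mathrm{red}(g_i)$ be the unique polynomial in $\bigoplus_{(m,p)=1}k\,X^m$ that is congruent to $g_i$ modulo $\wp(k[X])=\{P^p-P : P\in k[X]\}$. Let $C[n]$ be the curve over $k$ given by the equations $W_i^p-W_i=f_i(X)$, $1\le i\le n$, let $K_n=k(X,W_1,\dots,W_n)$ be its function field, and let $G[n]$ be the group of all $k$-automorphisms $\sigma$ of $K_n$ for which there is a $y\in V$ with $\sigma(X)=X+y$. Then an element $\sigma\in G[n]$ belongs to the center of $G[n]$ if and only if $$\sigma(X)=X\quad\text{and}\quad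 \sigma(W_i)=W_i\ \text{ for all } i\in\{1,\dots,n-1\}.$$ Moreover, the center of $G[n]$ is isomorphic to $\mathbb Z/p\mathbb Z$. -/

import Mathlib

open Polynomial
open scoped Nat

namespace BigAction

section Polynomials

variable (p : ℕ) [Fact p.Prime] (k : Type*) [Field k] [CharP k p]

/-- The operator `℘`, Frobenius minus identity. -/
def wp {A : Type*} [CommRing A] (a : A) : A := a ^ p - a

/-- `S(X) = ℘(X) = X ^ p - X`. -/
noncomputable def polyS : k[X] := wp p (X : k[X])

/-- `Q(X) = ℘(S(X))`. -/
noncomputable def polyQ : k[X] := wp p (polyS p k)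

variable {k} in
set_option linter.unusedSectionVars false in
theorem eval_polyQ (y : k) : (polyQ p k).eval y = (y ^ p - y) ^ p - (y ^ p - y) := by
  simp [polyQ, polyS, wp]

/-- The group `V` of zeroes of `Q` in `k`. -/
noncomputable def zerosQ : AddSubgroup k where
  carrier := {y | (polyQ p k).eval y = 0}
  zero_mem' := by
    have hp : p ≠ 0 := (Fact.out : p.Prime).ne_zero
    simp [eval_polyQ, hp]
  add_mem' := by
    intro a b ha hb
    simp only [Set.mem_ofPred_eq, eval_polyQ, sub_pow_char, add_pow_char] at *
    linear_combination ha + hb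
  neg_mem' := by
    intro a ha
    simp only [Set.mem_ofPred_eq, eval_polyQ] at *
    have h1 : (-a) ^ p = -(a ^ p) := by
      have := sub_pow_char (p := p) (0 : k) a
      simpa [(Fact.out : p.Prime).ne_zero] using this
    have h2 : (-(a ^ p)) ^ p = -((a ^ p) ^ p) := by
      have := sub_pow_char (p := p) (0 : k) (a ^ p)
      simpa [(Fact.out : p.Prime).ne_zero] using this
    rw [sub_pow_char] at ha
    rw [sub_pow_char, h1, h2]
    linear_combination -ha

theorem isUnit_factorial_witt : IsUnit (((p - 1)! : ℕ) : WittVector p k) := by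
  apply WittVector.isUnit_of_coeff_zero_ne_zero
  have h : ((((p - 1)! : ℕ) : WittVector p k)).coeff 0 = (((p - 1)! : ℕ) : k) :=
    map_natCast (WittVector.constantCoeff : WittVector p k →+* k) _
  rw [h, Ne, CharP.cast_eq_zero_iff k p, (Fact.out : p.Prime).dvd_factorial]
  have := (Fact.out : p.Prime).pos
  omega

/-- For odd `p`, the polynomial `(X ^ p - X) ^ p - X ^ (p ^ 2) + X ^ p` is divisible by `p!`
in `W(k)[X]`. -/
theorem exists_witt_quotient (hp : 3 ≤ p) : ∃ G : (WittVector p k)[X],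
    ((p ! : ℕ) : (WittVector p k)[X]) * G = (X ^ p - X) ^ p - X ^ (p ^ 2) + X ^ p := by
  have hP : p.Prime := Fact.out
  have hodd : Odd p := hP.odd_of_ne_two (by omega)
  obtain ⟨u, hu⟩ := (isUnit_factorial_witt p k).exists_right_inv
  obtain ⟨r, hr⟩ := exists_add_pow_prime_eq hP (X ^ p : (WittVector p k)[X]) (-X)
  have hfac : (p ! : ℕ) = p * (p - 1)! := (Nat.mul_factorial_pred hP.ne_zero).symm
  refine ⟨C u * (X ^ p * -X * r), ?_⟩
  have hu' : (((p - 1)! : ℕ) : (WittVector p k)[X]) * C u = 1 := by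
    rw [← C_eq_natCast, ← C_mul, hu, C_1]
  have h1 : ((X : (WittVector p k)[X]) ^ p) ^ p = X ^ (p ^ 2) := by rw [← pow_mul, pow_two]
  rw [sub_eq_add_neg (X ^ p) X, hr, h1, hodd.neg_pow, hfac, Nat.cast_mul]
  linear_combination ((p : (WittVector p k)[X]) * (X ^ p * -X * r)) * hu'

/-- The quotient is unique, because `W(k)` is a domain of characteristic zero. -/
theorem witt_quotient_unique {G G' : (WittVector p k)[X]}
    (h : ((p ! : ℕ) : (WittVector p k)[X]) * G = ((p ! : ℕ) : (WittVector p k)[X]) * G') :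
    G = G' := by
  have hfac : ((p ! : ℕ) : WittVector p k) ≠ 0 := by
    rw [← Nat.mul_factorial_pred (Fact.out : p.Prime).ne_zero, Nat.cast_mul]
    exact mul_ne_zero (WittVector.p_nonzero p k) (isUnit_factorial_witt p k).ne_zero
  rw [← C_eq_natCast] at h
  exact mul_left_cancel₀ (C_ne_zero.mpr hfac) h

/-- The reduction mod `p` (zeroth Witt coordinate) of the polynomial
`(1 / p!) ((X ^ p - X) ^ p - X ^ (p ^ 2) + X ^ p)` of `W(k)[X]`, for `p ≥ 3`. -/
noncomputable def polyGTop : k[X] :=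
  if hp : 3 ≤ p then
    (exists_witt_quotient p k hp).choose.map (WittVector.constantCoeff : WittVector p k →+* k)
  else 0

/-- `g_i = S ^ (i + 1) / (i + 1)!` for `i ≤ p - 2`, and `g_{p-1}` as above. -/
noncomputable def polyG (i : ℕ) : k[X] :=
  if i = p - 1 then polyGTop p k
  else C (((i + 1)! : ℕ) : k)⁻¹ * polyS p k ^ (i + 1)

variable {k}

/-- `r` is a `p`-power free polynomial congruent to `f` modulo `℘(k[X])`. -/
def IsReducedRepresentative (f r : k[X]) : Prop :=
  (∀ m, r.coeff m ≠ 0 → Nat.Coprime m p) ∧ ∃ P : k[X], f - r = wp p P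

theorem wp_add (P Q : k[X]) : wp p (P + Q) = wp p P + wp p Q := by
  simp only [wp, add_pow_char]; ring

theorem wp_sub (P Q : k[X]) : wp p (P - Q) = wp p P - wp p Q := by
  simp only [wp, sub_pow_char]; ring

theorem IsReducedRepresentative.add {f r g s : k[X]} (h : IsReducedRepresentative p f r)
    (h' : IsReducedRepresentative p g s) : IsReducedRepresentative p (f + g) (r + s) := by
  obtain ⟨h1, P, hP⟩ := h
  obtain ⟨h2, Q, hQ⟩ := h'
  refine ⟨fun m hm => ?_, P + Q, ?_⟩
  · by_cases hr : r.coeff m = 0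
    · exact h2 m (by simpa [hr] using hm)
    · exact h1 m hr
  · rw [wp_add, ← hP, ← hQ]; ring

theorem exists_reduced_monomial [IsAlgClosed k] (m : ℕ) (a : k) :
    ∃ r, IsReducedRepresentative p (monomial m a) r := by
  have hP : p.Prime := Fact.out
  induction m using Nat.strong_induction_on generalizing a with
  | _ m ih =>
    by_cases hm : p ∣ m
    · obtain ⟨l, rfl⟩ := hm
      rcases Nat.eq_zero_or_pos l with rfl | hl
      · have hdeg : (X ^ p - X - C a : k[X]).degree ≠ 0 := by
          have h : (X ^ p - X - C a : k[X]) = X ^ p - (X + C a) := by ring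
          rw [h, degree_sub_eq_left_of_degree_lt]
          · simpa using hP.ne_zero
          · rw [degree_X_add_C, degree_X_pow]
            exact_mod_cast hP.one_lt
        obtain ⟨b, hb⟩ := IsAlgClosed.exists_root _ hdeg
        refine ⟨0, by simp, C b, ?_⟩
        have hb' : b ^ p - b = a := by
          simpa [IsRoot, sub_eq_zero] using hb
        simp [wp, ← hb']
      · obtain ⟨b, hb⟩ := IsAlgClosed.exists_pow_nat_eq a hP.pos
        obtain ⟨r, hr1, P, hr2⟩ := ih l (by nlinarith [hP.two_le]) b
        refine ⟨r, hr1, P + monomial l b, ?_⟩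
        rw [wp_add, ← hr2, wp, monomial_pow, hb, mul_comm l p]
        ring
    · refine ⟨monomial m a, fun j hj => ?_, 0, by simp [wp, hP.ne_zero]⟩
      rw [coeff_monomial] at hj
      have : m = j := by by_contra h; simp [h] at hj
      subst this
      exact ((Nat.Prime.coprime_iff_not_dvd hP).mpr hm).symm

theorem exists_reduced [IsAlgClosed k] (f : k[X]) : ∃ r, IsReducedRepresentative p f r := by
  induction f using Polynomial.induction_on' with
  | add f g hf hg =>
    obtain ⟨r, hr⟩ := hf
    obtain ⟨s, hs⟩ := hg
    exact ⟨r + s, hr.add p hs⟩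
  | monomial m a => exact exists_reduced_monomial p m a

/-- The reduced representative is unique. -/
theorem IsReducedRepresentative.unique {f r s : k[X]} (h : IsReducedRepresentative p f r)
    (h' : IsReducedRepresentative p f s) : r = s := by
  have hP : p.Prime := Fact.out
  obtain ⟨h1, P, hP1⟩ := h
  obtain ⟨h2, Q, hQ1⟩ := h'
  have key : r - s = wp p (Q - P) := by rw [wp_sub, ← hP1, ← hQ1]; ring
  have hc : ∀ m, p ∣ m → (r - s).coeff m = 0 := by
    intro m hm
    have hn : ¬ Nat.Coprime m p := fun hcop =>
      (Nat.Prime.coprime_iff_not_dvd hP).mp hcop.symm hm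
    have a1 : r.coeff m = 0 := by by_contra h; exact hn (h1 m h)
    have a2 : s.coeff m = 0 := by by_contra h; exact hn (h2 m h)
    simp [a1, a2]
  set D := Q - P with hD
  rw [← sub_eq_zero]
  by_cases hd : D.natDegree = 0
  · obtain ⟨c, hcD⟩ := natDegree_eq_zero.mp hd
    have h0 := hc 0 (dvd_zero p)
    rw [key, ← hcD, wp, ← C_pow, ← C_sub, coeff_C_zero] at h0
    rw [key, ← hcD, wp, ← C_pow, ← C_sub, h0, C_0]
  · exfalso
    have h0 := hc (p * D.natDegree) (dvd_mul_right _ _)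
    have hlt : D.natDegree < p * D.natDegree := by nlinarith [hP.two_le, Nat.pos_of_ne_zero hd]
    rw [key, wp, coeff_sub, coeff_pow_mul_natDegree, coeff_eq_zero_of_natDegree_lt hlt,
      sub_zero] at h0
    have hD0 : D = 0 := leadingCoeff_eq_zero.mp (eq_zero_of_pow_eq_zero h0)
    exact hd (by simp [hD0])

/-- The reduced representative `red(f)` of `f`. -/
noncomputable def red [IsAlgClosed k] (f : k[X]) : k[X] := (exists_reduced p f).choose

theorem red_spec [IsAlgClosed k] (f : k[X]) : IsReducedRepresentative p f (red p f) :=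
  (exists_reduced p f).choose_spec

variable (k) in
/-- `f_i = red(g_i)`. -/
noncomputable def polyF [IsAlgClosed k] (i : ℕ) : k[X] := red p (polyG p k i)

end Polynomials

section Curve

variable (p : ℕ) [Fact p.Prime] (k : Type*) [Field k] [CharP k p] [IsAlgClosed k] (n : ℕ)

/-- The coordinate ring `k[X, W_1, …, W_n] / (W_i ^ p - W_i - f_i(X))` of the affine curve given
by the `n` Artin-Schreier equations. The variable `none` is `X`, and `some j` is `W_{j+1}`. -/
abbrev CoordRing : Type _ :=
  MvPolynomial (Option (Fin n)) k ⧸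
    Ideal.span (Set.range fun j : Fin n =>
      wp p (MvPolynomial.X (some j) : MvPolynomial (Option (Fin n)) k)
        - Polynomial.aeval (MvPolynomial.X none) (polyF p k (j + 1)))

/-- The function field `K_n = k(X, W_1, …, W_n)` of the curve `C[n]`, as the total ring of
fractions of the coordinate ring. The `f_i` are linearly independent over `F_p` modulo
`℘(k(X))`, so the affine curve is integral and this is its field of rational functions; nothing
of this is assumed. `k`-automorphisms of the smooth projective curve `C[n]` are the same as
`k`-automorphisms of `K_n`. -/
abbrev FunField : Type _ := FractionRing (CoordRing p k n)

/-- The element `X` of `K_n`. -/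
noncomputable def funX : FunField p k n :=
  algebraMap (CoordRing p k n) (FunField p k n)
    (Ideal.Quotient.mk _ (MvPolynomial.X none))

/-- The element `W_{j+1}` of `K_n`, for `j = 0, …, n - 1`. -/
noncomputable def funW (j : Fin n) : FunField p k n :=
  algebraMap (CoordRing p k n) (FunField p k n)
    (Ideal.Quotient.mk _ (MvPolynomial.X (some j)))

/-- The group `G[n]`: all `k`-automorphisms of `K_n` which extend a translation
`X ↦ X + y` with `y ∈ V`. It is the extension of `V` by the group `H[n]` of all
`k(X)`-automorphisms of `K_n`. -/
noncomputable def groupG : Subgroup (FunField p k n ≃ₐ[k] FunField p k n) where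
  carrier := {σ | ∃ y ∈ zerosQ p k, σ (funX p k n) = funX p k n + algebraMap k _ y}
  one_mem' := ⟨0, zero_mem _, by simp⟩
  mul_mem' := by
    rintro σ τ ⟨y, hy, hσ⟩ ⟨z, hz, hτ⟩
    refine ⟨y + z, add_mem hy hz, ?_⟩
    rw [AlgEquiv.mul_apply, hτ, map_add, hσ, AlgEquiv.commutes, map_add, add_assoc]
  inv_mem' := by
    rintro σ ⟨y, hy, hσ⟩
    refine ⟨-y, neg_mem hy, ?_⟩
    apply σ.injective
    have h : σ (σ⁻¹ (funX p k n)) = funX p k n := σ.apply_symm_apply _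
    rw [h, map_add, hσ, AlgEquiv.commutes, map_neg]
    ring

end Curve

end BigAction

/-!
Write `g_0 = S` and `w_0 = X`, and replace `W_j` by `w_j = W_j + R_j(X)`, where
`g_j - f_j = ℘(R_j)`. The curve is then given by `℘(w_j) = g_j(X)` for `0 ≤ j ≤ n`, and nothing
is left of the reduction `red`.

*The curve is integral.* The derivatives of the `g_i` show that they are independent over `F_p`
modulo `℘(k(X))` (`eq_zero_of_sum_polyG_eq_wp`). Hence the Galois group of `k(X)` translates
roots of the equations by arbitrary elements of `F_p ^ n`, so a polynomial of degree less than `p`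
in each `W_j` that vanishes at the roots is zero (`eq_zero_of_aeval_eq_zero`), and the coordinate
ring embeds into a field (`isDomain_coordRing`). In particular two solutions of one Artin-Schreier
equation in `K_n` differ by an element of `F_p`.

*The action.* For `y ∈ V` the element `s = S(y)` lies in `F_p`, and modulo `℘(k[X])` the `g_j`
behave as divided powers: `g_j(X + y) ≡ ∑_{i ≤ j} s ^ (j - i) / (j - i)! * g_i(X)`
(`exists_polyG_comp`). For `j < p - 1` this is the binomial formula. For `j = p - 1` it is the
cocycle identity for `((a + b) ^ p - a ^ p - b ^ p) / p`, of which `g_{p-1}` is the value at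
`(X ^ p, -X)` up to sign. So an element of `G[n]` above `y` maps `w_j` to
`∑_{i ≤ j} s ^ (j - i) / (j - i)! * w_i + D_j(X) + c_j` with `c_j ∈ F_p` (`shift`), and all
`y ∈ V` occur, as do, above `y = 0`, all constants `c_j`.

*The center.* The action on `w_1` gives the commutator pairing `S(z) * y - S(y) * z` on `V`, which
is nondegenerate, so a central element fixes `X` and maps `w_j` to `w_j + c_j`. Commutation with
an element above some `z` with `S(z) = 1` forces `c_1 = … = c_{n-1} = 0`, and then `c_n` is
arbitrary in `F_p` (`mem_center_iff`, `card_center`).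
-/

namespace BigAction

set_option linter.unusedSectionVars false

/-! ### Independent Artin-Schreier equations over a field -/

section ArtinSchreier

variable {p : ℕ}

theorem map_wp {A B E : Type*} [CommRing A] [CommRing B] [FunLike E A B] [RingHomClass E A B]
    (θ : E) (a : A) :
    θ (wp p a) = wp p (θ a) := by
  simp [wp]

theorem map_zmodCast {A B : Type*} [CommRing A] [CommRing B] [CharP A p] [CharP B p]
    (θ : A →+* B) (c : ZMod p) :
    θ (ZMod.castHom dvd_rfl A c) = ZMod.castHom dvd_rfl B c :=
  RingHom.congr_fun (Subsingleton.elim (θ.comp (ZMod.castHom dvd_rfl A)) _) c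

variable [Fact p.Prime]

theorem exists_zmod_of_wp_eq {L : Type*} [Field L] [CharP L p] {a b : L}
    (h : wp p a = wp p b) : ∃ c : ZMod p, a = b + ZMod.castHom dvd_rfl L c := by
  have hd : a - b ∈ (⊥ : Subfield L) := by
    rw [Subfield.mem_bot_iff_pow_eq_self L p, sub_pow_char]
    simp only [wp] at h
    linear_combination h
  rw [← ZMod.fieldRange_castHom_eq_bot p] at hd
  obtain ⟨c, hc⟩ := hd
  exact ⟨c, by rw [hc]; ring⟩

theorem wp_castHom_mul {L : Type*} [CommRing L] [CharP L p] (c : ZMod p) (a : L) :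
    wp p (ZMod.castHom dvd_rfl L c * a) = ZMod.castHom dvd_rfl L c * wp p a := by
  have : (ZMod.castHom dvd_rfl L c) ^ p = ZMod.castHom dvd_rfl L c := by
    rw [← map_pow, ZMod.pow_card]
  rw [wp, wp, mul_pow, this]
  ring

theorem wp_add_char {A : Type*} [CommRing A] [CharP A p] (a b : A) :
    wp p (a + b) = wp p a + wp p b := by
  simp only [wp, add_pow_char]
  ring

theorem wp_sub_char {A : Type*} [CommRing A] [CharP A p] (a b : A) :
    wp p (a - b) = wp p a - wp p b := by
  simp only [wp, sub_pow_char]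
  ring

theorem wp_sum {A ι : Type*} [CommRing A] [CharP A p] (s : Finset ι) (a : ι → A) :
    wp p (∑ i ∈ s, a i) = ∑ i ∈ s, wp p (a i) := by
  simp only [wp, sum_pow_char, Finset.sum_sub_distrib]

/-- If the `f i` are independent over `F_p` modulo `℘(F)`, the Galois group moves the roots
`w i` of `℘(w i) = f i` by arbitrary independent elements of `F_p`: a proper `F_p`-subspace of
translations would be killed by some nonzero functional `a`, and then `∑ a i * w i` would be
Galois invariant, so that `∑ a i * f i` would lie in `℘(F)`. -/
theorem exists_galois_translate {F L ι : Type*} [Field F] [Field L] [Algebra F L] [IsGalois F L]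
    [CharP F p] [CharP L p] [Fintype ι] {f : ι → F} {w : ι → L}
    (hw : ∀ i, wp p (w i) = algebraMap F L (f i))
    (hind : ∀ (c : ι → ZMod p) (u : F),
      wp p u = ∑ i, ZMod.castHom dvd_rfl F (c i) * f i → c = 0)
    (c : ι → ZMod p) :
    ∃ σ : L ≃ₐ[F] L, ∀ i, σ (w i) = w i + ZMod.castHom dvd_rfl L (c i) := by
  classical
  let T : AddSubgroup (ι → ZMod p) :=
    { carrier := {c | ∃ σ : L ≃ₐ[F] L, ∀ i, σ (w i) = w i + ZMod.castHom dvd_rfl L (c i)}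
      zero_mem' := ⟨1, by simp⟩
      add_mem' := by
        rintro a b ⟨σ, hσ⟩ ⟨τ, hτ⟩
        refine ⟨σ * τ, fun i => ?_⟩
        rw [AlgEquiv.mul_apply, hτ, map_add, hσ, ← RingHom.coe_coe σ, map_zmodCast, Pi.add_apply,
          map_add]
        ring
      neg_mem' := by
        rintro a ⟨σ, hσ⟩
        refine ⟨σ⁻¹, fun i => σ.injective ?_⟩
        have h : σ (σ⁻¹ (w i)) = w i := σ.apply_symm_apply _
        rw [h, map_add, hσ, ← RingHom.coe_coe σ, map_zmodCast, Pi.neg_apply, map_neg]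
        ring }
  by_contra hc
  have hlt : AddSubgroup.toZModSubmodule p T < ⊤ := by
    rw [lt_top_iff_ne_top]
    intro h
    have : c ∈ AddSubgroup.toZModSubmodule p T := h ▸ Submodule.mem_top
    exact hc this
  obtain ⟨θ, hθ, hle⟩ := Submodule.exists_le_ker_of_lt_top _ hlt
  let a : ι → ZMod p := fun i => θ (Pi.single i 1)
  have hθa : ∀ v, θ v = ∑ i, a i * v i := fun v => by
    conv_lhs => rw [← Finset.univ_sum_single v, map_sum]
    refine Finset.sum_congr rfl fun i _ => ?_
    have : (Pi.single i (v i) : ι → ZMod p) = v i • Pi.single i 1 := by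
      rw [← Pi.single_smul, smul_eq_mul, mul_one]
    rw [this, map_smul, smul_eq_mul, mul_comm]
  let u : L := ∑ i, ZMod.castHom dvd_rfl L (a i) * w i
  have hu : u ∈ Set.range (algebraMap F L) := by
    rw [InfiniteGalois.mem_range_algebraMap_iff_fixed]
    intro σ
    have hv : ∀ i, ∃ v : ZMod p, σ (w i) = w i + ZMod.castHom dvd_rfl L v := fun i =>
      exists_zmod_of_wp_eq (by
        rw [← RingHom.coe_coe σ, ← map_wp, hw, RingHom.coe_coe, AlgEquiv.commutes])
    choose v hv using hv
    have hvT : v ∈ AddSubgroup.toZModSubmodule p T := ⟨σ, hv⟩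
    have h0 : θ v = 0 := hle hvT
    have hcast : ∀ c, σ (ZMod.castHom dvd_rfl L c) = ZMod.castHom dvd_rfl L c :=
      map_zmodCast (σ : L →+* L)
    simp only [u, map_sum, map_mul, hcast, hv, mul_add, Finset.sum_add_distrib]
    rw [add_eq_left]
    rw [hθa] at h0
    simpa only [map_sum, map_mul, map_zero] using congrArg (ZMod.castHom dvd_rfl L) h0
  obtain ⟨u₀, hu₀⟩ := hu
  have ha : a = 0 := by
    refine hind a u₀ ((algebraMap F L).injective ?_)
    rw [map_wp, hu₀, map_sum, wp_sum]
    refine Finset.sum_congr rfl fun i _ => ?_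
    rw [wp_castHom_mul, hw, map_mul, map_zmodCast]
  refine hθ (LinearMap.ext fun v => ?_)
  rw [hθa, ha]
  simp

/-- A relation of degree less than `p` in each of the roots `w i` is trivial: its Galois conjugates
make the polynomial vanish on a product of sets of size `p`. -/
theorem eq_zero_of_aeval_eq_zero {R F L ι : Type*} [CommRing R] [Field F]
    [Field L] [Algebra R F] [Algebra F L] [Algebra R L] [IsScalarTower R F L]
    [FaithfulSMul R L] [IsGalois F L]
    [CharP F p] [CharP L p] [Fintype ι] {f : ι → F} {w : ι → L}
    (hw : ∀ i, wp p (w i) = algebraMap F L (f i))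
    (hind : ∀ (c : ι → ZMod p) (u : F),
      wp p u = ∑ i, ZMod.castHom dvd_rfl F (c i) * f i → c = 0)
    {r : MvPolynomial ι R} (hdeg : ∀ i, r.degreeOf i < p) (hr : MvPolynomial.aeval w r = 0) :
    r = 0 := by
  classical
  have hinj : Function.Injective (algebraMap R L) := FaithfulSMul.algebraMap_injective R L
  apply MvPolynomial.map_injective (algebraMap R L) hinj
  rw [map_zero]
  refine MvPolynomial.eq_zero_of_eval_zero_at_prod_finset _
    (fun i => Finset.univ.image fun c : ZMod p => w i + ZMod.castHom dvd_rfl L c) ?_ ?_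
  · intro i
    rw [Finset.card_image_of_injective _
      fun a b h => (ZMod.castHom (dvd_refl p) L).injective (add_left_cancel h),
      Finset.card_univ, ZMod.card]
    refine lt_of_le_of_lt ?_ (hdeg i)
    rw [MvPolynomial.degreeOf_eq_sup, MvPolynomial.degreeOf_eq_sup]
    exact Finset.sup_mono (MvPolynomial.support_map_subset _ _)
  · intro x hx
    simp only [Finset.mem_image, Finset.mem_univ, true_and] at hx
    choose c hc using hx
    obtain ⟨σ, hσ⟩ := exists_galois_translate hw hind c
    have hx : x = fun i => σ (w i) := funext fun i => by rw [hσ, hc]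
    have := congrArg ((σ.toAlgHom.restrictScalars R)) hr
    rw [← AlgHom.comp_apply, MvPolynomial.comp_aeval, map_zero] at this
    rw [MvPolynomial.eval_map, ← MvPolynomial.aeval_def, hx]
    exact this

/-- The Artin-Schreier equations generate all relations between the roots `w i` over `R`: dividing
by them leaves a remainder of degree less than `p` in each variable. -/
theorem mem_span_of_aeval_eq_zero {R F L ι : Type*} [CommRing R] [Field F]
    [Field L] [Algebra R F] [Algebra F L] [Algebra R L] [IsScalarTower R F L]
    [FaithfulSMul R L] [IsGalois F L]
    [CharP F p] [CharP L p] [Fintype ι] {f : ι → R} {w : ι → L}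
    (hw : ∀ i, wp p (w i) = algebraMap R L (f i))
    (hind : ∀ (c : ι → ZMod p) (u : F),
      wp p u = ∑ i, ZMod.castHom dvd_rfl F (c i) * algebraMap R F (f i) → c = 0)
    {P : MvPolynomial ι R} (hP : MvPolynomial.aeval w P = 0) :
    P ∈ Ideal.span (Set.range fun i =>
      wp p (MvPolynomial.X i : MvPolynomial ι R) - MvPolynomial.C (f i)) := by
  classical
  let _ : LinearOrder ι := WellOrderingRel.isWellOrder.linearOrder
  have : Nontrivial R := (algebraMap R L).domain_nontrivial
  have hp1 : 1 < p := (Fact.out : p.Prime).one_lt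
  let b : ι → MvPolynomial ι R := fun i => wp p (MvPolynomial.X i) - MvPolynomial.C (f i)
  -- In a degree order over `R` the leading term of each relation is `X i ^ p`, whatever `f i` is.
  let m := MonomialOrder.degLex (σ := ι)
  have hbX : ∀ i, b i = MvPolynomial.X i ^ p - (MvPolynomial.X i + MvPolynomial.C (f i)) :=
    fun i => by simp only [b, wp]; ring
  have hdX : ∀ i, m.degree (MvPolynomial.X i ^ p : MvPolynomial ι R) = Finsupp.single i p :=
    fun i => by
      rw [MvPolynomial.X_pow_eq_monomial, MonomialOrder.degree_monomial, if_neg one_ne_zero]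
  have hlt : ∀ i, m.toSyn (m.degree (MvPolynomial.X i + MvPolynomial.C (f i))) <
      m.toSyn (m.degree (MvPolynomial.X i ^ p : MvPolynomial ι R)) := fun i => by
    refine lt_of_le_of_lt (MonomialOrder.degree_add_le) ?_
    rw [hdX, MonomialOrder.degree_C, MonomialOrder.degree_X]
    have hlt (k l : ℕ) (h : k < l) :
        m.toSyn (Finsupp.single i k) < m.toSyn (Finsupp.single i l) :=
      m.toSyn_strictMono (lt_of_le_of_ne (Finsupp.single_mono h.le)
        ((Finsupp.single_injective i).ne h.ne))
    exact max_lt (hlt 1 p hp1) (by simpa using hlt 0 p (by omega))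
  have hdb : ∀ i, m.degree (b i) = Finsupp.single i p := fun i => by
    rw [hbX, MonomialOrder.degree_sub_of_lt (hlt i), hdX]
  have hlc : ∀ i, IsUnit (m.leadingCoeff (b i)) := fun i => by
    rw [hbX, MonomialOrder.leadingCoeff_sub_of_lt (hlt i), MvPolynomial.X_pow_eq_monomial,
      MonomialOrder.leadingCoeff_monomial]
    exact isUnit_one
  obtain ⟨g, r, hPr, -, hr⟩ := m.div hlc P
  have hb : ∀ i, MvPolynomial.aeval w (b i) = 0 := fun i => by
    simp only [b, map_sub, MvPolynomial.aeval_C, ← hw]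
    simp [wp]
  have hr0 : r = 0 := by
    refine eq_zero_of_aeval_eq_zero (F := F) (w := w) (f := fun i => algebraMap R F (f i))
      (fun i => by rw [hw, IsScalarTower.algebraMap_apply R F L]) hind (fun i => ?_) ?_
    · rw [MvPolynomial.degreeOf_eq_sup, Finset.sup_lt_iff (by simp; omega)]
      intro c hc
      have := hr c hc i
      rw [hdb, Finsupp.single_le_iff] at this
      omega
    · rw [hPr, map_add, Finsupp.linearCombination_apply, map_finsuppSum,
        Finsupp.sum, Finset.sum_eq_zero fun i _ => by rw [smul_eq_mul, map_mul, hb, mul_zero],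
        zero_add] at hP
      exact hP
  rw [hPr, hr0, add_zero, Finsupp.linearCombination_apply]
  exact Submodule.finsuppSum_mem _ _ _ _ fun i _ =>
    Ideal.mul_mem_left _ _ (Ideal.subset_span ⟨i, rfl⟩)

end ArtinSchreier

/-! ### The Witt carry polynomial -/

section Carry

/-- The polynomial `((a + b) ^ p - a ^ p - b ^ p) / p`, with its integral coefficients
`(p.choose m) / p` (an exact division of natural numbers for prime `p`). -/
def carry (p : ℕ) {A : Type*} [CommRing A] (a b : A) : A :=
  ∑ m ∈ Finset.Ico 1 p, ((p.choose m / p : ℕ) : A) * a ^ m * b ^ (p - m)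

variable {p : ℕ}

theorem map_carry {A B : Type*} [CommRing A] [CommRing B] (θ : A →+* B) (a b : A) :
    θ (carry p a b) = carry p (θ a) (θ b) := by
  simp [carry]

variable [Fact p.Prime]

theorem natCast_mul_carry {A : Type*} [CommRing A] (a b : A) :
    (p : A) * carry p a b = (a + b) ^ p - a ^ p - b ^ p := by
  have hP : p.Prime := Fact.out
  have h1 : ∀ m ∈ Finset.Ico 1 p, (p : A) * (((p.choose m / p : ℕ) : A) * a ^ m * b ^ (p - m)) =
      a ^ m * b ^ (p - m) * (p.choose m : A) := fun m hm => by
    rw [Finset.mem_Ico] at hm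
    have : p ∣ p.choose m := hP.dvd_choose_self (by omega) hm.2
    conv_rhs => rw [← Nat.mul_div_cancel' this, Nat.cast_mul]
    ring
  rw [carry, Finset.mul_sum, Finset.sum_congr rfl h1, add_pow, Finset.sum_range_succ,
    Finset.range_eq_Ico, Finset.sum_eq_sum_Ico_succ_bot hP.pos]
  simp

/-- `carry` is the coboundary of `a ^ p / p`; here in four variables. It is enough to check this in
a polynomial ring over `ℤ`, where `p` can be cancelled. -/
theorem carry_add_add {A : Type*} [CommRing A] (a b a' b' : A) :
    carry p (a + a') (b + b') + carry p a a' + carry p b b' =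
      carry p a b + carry p a' b' + carry p (a + b) (a' + b') := by
  have key : ∀ a b a' b' : MvPolynomial (Fin 4) ℤ,
      carry p (a + a') (b + b') + carry p a a' + carry p b b' =
      carry p a b + carry p a' b' + carry p (a + b) (a' + b') := fun a b a' b' => by
    have hp0 : (p : MvPolynomial (Fin 4) ℤ) ≠ 0 :=
      Nat.cast_ne_zero.mpr (Fact.out : p.Prime).ne_zero
    apply mul_left_cancel₀ hp0
    simp only [mul_add, natCast_mul_carry]
    rw [add_add_add_comm a a' b b']
    ring
  have := congrArg (MvPolynomial.eval₂Hom (Int.castRingHom A) ![a, b, a', b'])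
    (key (MvPolynomial.X 0) (MvPolynomial.X 1) (MvPolynomial.X 2) (MvPolynomial.X 3))
  simp only [map_add, map_carry, MvPolynomial.eval₂Hom_X'] at this
  simpa using this

theorem carry_neg_neg (hp : 3 ≤ p) {A : Type*} [CommRing A] (a b : A) :
    carry p (-a) (-b) = -carry p a b := by
  have hodd : Odd p := (Fact.out : p.Prime).odd_of_ne_two (by omega)
  rw [carry, carry, ← Finset.sum_neg_distrib]
  refine Finset.sum_congr rfl fun m hm => ?_
  rw [Finset.mem_Ico] at hm
  have h : (-1 : A) ^ m * (-1) ^ (p - m) = -1 := by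
    rw [← pow_add, Nat.add_sub_cancel' hm.2.le, hodd.neg_one_pow]
  rw [neg_pow a, neg_pow b]
  linear_combination ((p.choose m / p : ℕ) : A) * a ^ m * b ^ (p - m) * h

theorem carry_pow_pow {A : Type*} [CommRing A] [CharP A p] (a b : A) :
    carry p (a ^ p) (b ^ p) = carry p a b ^ p :=
  (map_carry (frobenius A p) a b).symm

end Carry

/-! ### The polynomials `g_i`: independence modulo `℘` and behaviour under translation -/

section Polynomials

variable {p : ℕ} [Fact p.Prime] {k : Type*} [Field k] [CharP k p]

theorem factorial_ne_zero_of_lt {m : ℕ} (hm : m < p) : ((m ! : ℕ) : k) ≠ 0 := by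
  rw [Ne, CharP.cast_eq_zero_iff k p, (Fact.out : p.Prime).dvd_factorial]
  omega

theorem factorial_pred_eq_neg_one : (((p - 1)! : ℕ) : k) = -1 := by
  have := congrArg (ZMod.castHom dvd_rfl k) (ZMod.wilsons_lemma p)
  simpa only [map_natCast, map_neg, map_one] using this

theorem polyGTop_eq (hp : 3 ≤ p) : polyGTop p k = -carry p (X ^ p) (-X) := by
  have hP : p.Prime := Fact.out
  have hodd : Odd p := hP.odd_of_ne_two (by omega)
  set G := (exists_witt_quotient p k hp).choose with hG
  have hspec := (exists_witt_quotient p k hp).choose_spec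
  rw [← hG] at hspec
  have hp0 : (p : (WittVector p k)[X]) ≠ 0 := by
    rw [← C_eq_natCast]
    exact C_ne_zero.mpr (WittVector.p_nonzero p k)
  have h1 : (((p - 1)! : ℕ) : (WittVector p k)[X]) * G = carry p (X ^ p) (-X) := by
    apply mul_left_cancel₀ hp0
    rw [natCast_mul_carry, ← mul_assoc, ← Nat.cast_mul, Nat.mul_factorial_pred hP.ne_zero, hspec,
      hodd.neg_pow]
    ring
  have h2 := congrArg (mapRingHom (WittVector.constantCoeff : WittVector p k →+* k)) h1
  rw [map_carry, map_mul, map_natCast, ← C_eq_natCast, factorial_pred_eq_neg_one] at h2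
  simp only [coe_mapRingHom, map_neg, C_1, Polynomial.map_pow, map_X] at h2
  rw [polyGTop, dif_pos hp, ← hG, ← h2]
  ring

/-- Differentiating `p * carry (X ^ p) (-X) = (X ^ p - X) ^ p - X ^ (p ^ 2) + X ^ p` over `ℤ` and
cancelling `p` gives a formula that survives the reduction mod `p`. -/
theorem derivative_carry (hp : 3 ≤ p) :
    derivative (carry p (X ^ p) (-X) : k[X]) = X ^ (p - 1) - polyS p k ^ (p - 1) := by
  have hP : p.Prime := Fact.out
  have hodd : Odd p := hP.odd_of_ne_two (by omega)
  have h1 : derivative (carry p (X ^ p) (-X) : ℤ[X]) =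
      ((X : ℤ[X]) ^ p - X) ^ (p - 1) * ((p : ℤ[X]) * X ^ (p - 1) - 1) -
        (p : ℤ[X]) * X ^ (p * p - 1) + X ^ (p - 1) := by
    have hp0 : (p : ℤ[X]) ≠ 0 := Nat.cast_ne_zero.mpr hP.ne_zero
    apply mul_left_cancel₀ hp0
    have := congrArg derivative (natCast_mul_carry (p := p) (X ^ p) (-X : ℤ[X]))
    rw [← C_eq_natCast, derivative_C_mul, C_eq_natCast] at this
    rw [this, hodd.neg_pow, ← pow_mul, ← sub_eq_add_neg]
    simp only [derivative_sub, derivative_pow, derivative_X, derivative_neg, Nat.cast_mul,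
      C_mul, C_eq_natCast]
    ring
  have h2 := congrArg (mapRingHom (Int.castRingHom k)) h1
  rw [coe_mapRingHom, ← derivative_map, ← coe_mapRingHom, map_carry] at h2
  simp only [coe_mapRingHom, Polynomial.map_sub, Polynomial.map_add, Polynomial.map_mul,
    Polynomial.map_pow, map_X, Polynomial.map_neg, Polynomial.map_natCast, CharP.cast_eq_zero,
    Polynomial.map_one] at h2
  rw [h2, polyS, wp]
  ring

theorem polyG_of_lt {i : ℕ} (hi : i + 1 < p) :
    polyG p k i = C (((i + 1)! : ℕ) : k)⁻¹ * polyS p k ^ (i + 1) := by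
  rw [polyG, if_neg (by omega)]

theorem polyG_pred (hp : 3 ≤ p) : polyG p k (p - 1) = -carry p (X ^ p) (-X) := by
  rw [polyG, if_pos rfl, polyGTop_eq hp]

theorem polyG_zero (hp : 3 ≤ p) : polyG p k 0 = polyS p k := by
  rw [polyG_of_lt (by omega)]
  simp

theorem natDegree_polyS : (polyS p k).natDegree = p :=
  FiniteField.X_pow_card_sub_X_natDegree_eq k (Fact.out : p.Prime).one_lt

theorem natDegree_wp (P : k[X]) : (wp p P).natDegree = p * P.natDegree := by
  have hP : p.Prime := Fact.out
  rcases Nat.eq_zero_or_pos P.natDegree with h | h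
  · rw [natDegree_eq_zero] at h
    obtain ⟨c, rfl⟩ := h
    rw [← map_wp C c, natDegree_C, natDegree_C, mul_zero]
  · have hlt : P.natDegree < (P ^ p).natDegree := by
      rw [natDegree_pow]
      nlinarith [hP.two_le]
    rw [wp, natDegree_sub_eq_left_of_natDegree_lt hlt, natDegree_pow]

theorem natDegree_polyG_le (hp : 3 ≤ p) {i : ℕ} (hi : i < p) :
    (polyG p k i).natDegree ≤ p * p := by
  rcases Nat.lt_or_ge (i + 1) p with h | h
  · rw [polyG_of_lt h]
    refine (natDegree_C_mul_le _ _).trans ?_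
    rw [natDegree_pow, natDegree_polyS]
    gcongr
  · obtain rfl : i = p - 1 := by omega
    rw [polyG_pred hp, natDegree_neg, carry]
    refine natDegree_sum_le_of_forall_le _ _ fun m hm => ?_
    rw [Finset.mem_Ico] at hm
    rw [← C_eq_natCast, mul_assoc]
    refine (natDegree_C_mul_le _ _).trans (natDegree_mul_le.trans ?_)
    rw [← pow_mul, natDegree_X_pow, natDegree_pow, natDegree_neg, natDegree_X]
    obtain ⟨l, rfl⟩ := Nat.exists_eq_add_of_le hm.2.le
    rw [Nat.add_sub_cancel_left]
    nlinarith [hm.1]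

theorem derivative_wp (P : k[X]) : derivative (wp p P) = -derivative P := by
  simp only [wp, derivative_sub, derivative_pow, CharP.cast_eq_zero, C_0]
  ring

theorem derivative_polyS : derivative (polyS p k) = -1 := by
  rw [polyS, derivative_wp, derivative_X]

/-- Up to sign, the derivative of `g_i` is the divided power `S ^ i / i!`; the top one has the defect
`X ^ (p - 1)`, caused by the term `X ^ p / p!` of the Witt lift. -/
theorem derivative_polyG (hp : 3 ≤ p) {i : ℕ} (hi : i < p) :
    derivative (polyG p k i) = -(C ((i ! : ℕ) : k)⁻¹ * polyS p k ^ i) -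
      if i = p - 1 then X ^ (p - 1) else 0 := by
  rcases Nat.lt_or_ge (i + 1) p with h | h
  · have h0 : ((i + 1 : ℕ) : k) ≠ 0 := by
      rw [Ne, CharP.cast_eq_zero_iff k p]
      exact Nat.not_dvd_of_pos_of_lt (by omega) h
    rw [polyG_of_lt h, if_neg (by omega), derivative_C_mul, derivative_pow, derivative_polyS,
      Nat.factorial_succ, Nat.cast_mul, mul_inv_rev, C_mul, Nat.add_sub_cancel]
    have : (C ((i + 1 : ℕ) : k)⁻¹ : k[X]) * C ((i + 1 : ℕ) : k) = 1 := by
      rw [← C_mul, inv_mul_cancel₀ h0, C_1]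
    linear_combination -(C ((i ! : ℕ) : k)⁻¹ * polyS p k ^ i) * this
  · obtain rfl : i = p - 1 := by omega
    rw [polyG_pred hp, derivative_neg, derivative_carry hp, if_pos rfl, factorial_pred_eq_neg_one]
    simp

/-- The `g_i`, `1 ≤ i ≤ p - 1`, are linearly independent modulo `℘(k[X])`. If `∑ c i * g_i = ℘(P)`,
then `deg P ≤ p`. Differentiating, a polynomial `T(S)` has degree at most `p - 1`, although its
degree is `p * deg T`; so `T` is constant, and its coefficients are the `c i` up to units. -/
theorem eq_zero_of_sum_polyG_eq_wp (hp : 3 ≤ p) {n : ℕ} (hn : n ≤ p - 1) {c : Fin n → k}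
    {P : k[X]} (h : ∑ i, C (c i) * polyG p k (i + 1) = wp p P) : c = 0 := by
  have hP : p.Prime := Fact.out
  have hdeg : P.natDegree ≤ p := by
    have : (wp p P).natDegree ≤ p * p := by
      rw [← h]
      refine natDegree_sum_le_of_forall_le _ _ fun i _ => ?_
      exact (natDegree_C_mul_le _ _).trans (natDegree_polyG_le hp (by omega))
    rw [natDegree_wp] at this
    exact Nat.le_of_mul_le_mul_left this hP.pos
  let T : k[X] := ∑ i : Fin n, C (c i * (((i + 1 : ℕ)! : ℕ) : k)⁻¹) * X ^ (i + 1 : ℕ)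
  have hT : T.comp (polyS p k) = derivative P -
      ∑ i : Fin n, C (c i) * (if (i + 1 : ℕ) = p - 1 then X ^ (p - 1) else 0) := by
    have h' := congrArg derivative h
    rw [derivative_wp, derivative_sum] at h'
    rw [← neg_neg (derivative P), ← h', ← sub_eq_zero]
    simp only [T, Polynomial.sum_comp, mul_comp, C_comp, pow_comp, X_comp, derivative_C_mul]
    rw [← Finset.sum_neg_distrib, ← Finset.sum_sub_distrib, ← Finset.sum_sub_distrib]
    refine Finset.sum_eq_zero fun i _ => ?_
    rw [derivative_polyG hp (by omega), C_mul]
    ring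
  have hTdeg : (T.comp (polyS p k)).natDegree ≤ p - 1 := by
    rw [hT]
    refine (natDegree_sub_le _ _).trans (max_le ?_ ?_)
    · exact (natDegree_derivative_le _).trans (by omega)
    · refine natDegree_sum_le_of_forall_le _ _ fun i _ => ?_
      refine (natDegree_C_mul_le _ _).trans ?_
      split_ifs <;> simp
  rw [natDegree_comp, natDegree_polyS] at hTdeg
  have hT0 : T.natDegree = 0 := by
    by_contra h0
    have := Nat.le_mul_of_pos_left p (Nat.pos_of_ne_zero h0)
    have := hP.pos
    omega
  funext i
  have hc : T.coeff (i + 1) = c i * (((i + 1 : ℕ)! : ℕ) : k)⁻¹ := by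
    simp only [T, finsetSum_coeff, coeff_C_mul, coeff_X_pow]
    rw [Finset.sum_eq_single i]
    · simp
    · intro j _ hj
      rw [if_neg (fun h => hj (Fin.ext (by omega))), mul_zero]
    · simp
  rw [coeff_eq_zero_of_natDegree_lt (by omega)] at hc
  exact (mul_eq_zero.mp hc.symm).resolve_right
    (inv_ne_zero (factorial_ne_zero_of_lt (by omega)))

/-- The divided power `s ^ m / m!`. -/
def dividedPow (s : k) (m : ℕ) : k := ((m ! : ℕ) : k)⁻¹ * s ^ m

theorem dividedPow_zero (s : k) : dividedPow s 0 = 1 := by simp [dividedPow]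

theorem dividedPow_one (s : k) : dividedPow s 1 = s := by simp [dividedPow]

theorem dividedPow_pow {s : k} (hs : s ^ p = s) (m : ℕ) :
    dividedPow s m ^ p = dividedPow s m := by
  rw [dividedPow, mul_pow, inv_pow, ← frobenius_def, map_natCast, ← pow_mul, mul_comm m, pow_mul,
    hs]

theorem polyS_comp (y : k) : (polyS p k).comp (X + C y) = polyS p k + C (wp p y) := by
  simp only [polyS, wp, sub_comp, pow_comp, X_comp, add_pow_char, C_sub, C_pow]
  ring

/-- The binomial formula for the divided powers of `S(X + y) = S(X) + S(y)`. -/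
theorem polyG_comp_of_lt {j : ℕ} (hj : j + 1 < p) (y : k) :
    (polyG p k j).comp (X + C y) =
      ∑ i ∈ Finset.range (j + 1), C (dividedPow (wp p y) (j - i)) * polyG p k i +
        C (dividedPow (wp p y) (j + 1)) := by
  rw [polyG_of_lt hj, mul_comp, C_comp, pow_comp, polyS_comp, add_pow, Finset.sum_range_succ',
    mul_add, Finset.mul_sum]
  congr 1
  · refine Finset.sum_congr rfl fun i hi => ?_
    rw [Finset.mem_range] at hi
    rw [polyG_of_lt (by omega), dividedPow, Nat.add_sub_add_right, ← C_eq_natCast, ← C_pow]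
    have h1 := Nat.choose_mul_factorial_mul_factorial (n := j + 1) (k := i + 1) (by omega)
    rw [Nat.add_sub_add_right] at h1
    have h1 := congrArg (Nat.cast : ℕ → k) h1
    rw [Nat.cast_mul, Nat.cast_mul] at h1
    have a1 := factorial_ne_zero_of_lt (p := p) (k := k) (m := j + 1) (by omega)
    have a2 := factorial_ne_zero_of_lt (p := p) (k := k) (m := i + 1) (by omega)
    have a3 := factorial_ne_zero_of_lt (p := p) (k := k) (m := j - i) (by omega)
    have : ((((j + 1)! : ℕ) : k)⁻¹ * ((j + 1).choose (i + 1) : k)) =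
        (((j - i)! : ℕ) : k)⁻¹ * (((i + 1)! : ℕ) : k)⁻¹ := by
      field_simp
      linear_combination h1
    have := congrArg (C : k → k[X]) this
    simp only [C_mul] at this ⊢
    linear_combination (polyS p k ^ (i + 1) * C (wp p y ^ (j - i))) * this
  · simp [dividedPow]

/-- `-carry(S, s)` is `(S + s) ^ p / p!` without its two extreme terms, as `(p - 1)! = -1`. -/
theorem neg_carry_polyS (hp : 3 ≤ p) (s : k) :
    -carry p (polyS p k) (C s) =
      ∑ i ∈ Finset.range (p - 1), C (dividedPow s (p - 1 - i)) * polyG p k i := by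
  have hP : p.Prime := Fact.out
  rw [carry, ← Finset.sum_neg_distrib, Finset.sum_Ico_eq_sum_range]
  refine Finset.sum_congr rfl fun i hi => ?_
  rw [Finset.mem_range] at hi
  rw [polyG_of_lt (by omega), dividedPow, ← C_eq_natCast, ← C_pow, add_comm 1 i,
    show p - 1 - i = p - (i + 1) by omega]
  have h1 := Nat.choose_mul_factorial_mul_factorial (n := p) (k := i + 1) (by omega)
  obtain ⟨q, hq⟩ := hP.dvd_choose_self (k := i + 1) (by omega) (by omega)
  have h2 : p.choose (i + 1) / p = q := by rw [hq, Nat.mul_div_cancel_left _ hP.pos]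
  rw [hq, ← Nat.mul_factorial_pred hP.ne_zero, mul_assoc, mul_assoc] at h1
  have h1 := congrArg (Nat.cast : ℕ → k) (Nat.eq_of_mul_eq_mul_left hP.pos h1)
  rw [Nat.cast_mul, Nat.cast_mul, factorial_pred_eq_neg_one] at h1
  have a2 := factorial_ne_zero_of_lt (p := p) (k := k) (m := i + 1) (by omega)
  have a3 := factorial_ne_zero_of_lt (p := p) (k := k) (m := p - (i + 1)) (by omega)
  have : -(q : k) = (((p - (i + 1))! : ℕ) : k)⁻¹ * (((i + 1)! : ℕ) : k)⁻¹ := by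
    field_simp
    linear_combination -h1
  have := congrArg (C : k → k[X]) this
  rw [h2]
  simp only [C_mul, C_neg] at this ⊢
  linear_combination (polyS p k ^ (i + 1) * C (s ^ (p - (i + 1)))) * this

/-- The top polynomial obeys the same binomial formula as the others, up to `℘` of the polynomial
`carry(X, y)`: this is the cocycle identity for `X ^ p - X` and `y ^ p - y`. -/
theorem polyG_pred_comp (hp : 3 ≤ p) (y : k) :
    (polyG p k (p - 1)).comp (X + C y) =
      ∑ i ∈ Finset.range p, C (dividedPow (wp p y) (p - 1 - i)) * polyG p k i +
        (wp p (carry p X (C y)) - C (carry p (y ^ p) (-y))) := by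
  have hP : p.Prime := Fact.out
  have h := carry_add_add (p := p) (X ^ p : k[X]) (-X) (C y ^ p) (-C y)
  rw [carry_pow_pow, carry_neg_neg hp, ← sub_eq_add_neg (X ^ p), ← sub_eq_add_neg (C y ^ p),
    ← wp, ← polyS, ← wp, ← map_wp, ← add_pow_char, ← neg_add] at h
  have hc : (carry p (X ^ p) (-X) : k[X]).comp (X + C y) =
      carry p ((X + C y) ^ p) (-(X + C y)) := by
    rw [← coe_compRingHom_apply, map_carry]
    simp
  have hC : (C (carry p (y ^ p) (-y)) : k[X]) = carry p (C y ^ p) (-C y) := by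
    rw [map_carry, C_pow, C_neg]
  have hr : Finset.range p = Finset.range (p - 1 + 1) := by rw [Nat.sub_add_cancel hP.one_le]
  rw [hr, Finset.sum_range_succ, ← neg_carry_polyS hp, Nat.sub_self, dividedPow_zero, C_1, one_mul,
    polyG_pred hp, neg_comp, hc, hC]
  have hw : wp p (carry p X (C y) : k[X]) = carry p X (C y) ^ p - carry p X (C y) := rfl
  linear_combination -h - hw

theorem wp_surjective [IsAlgClosed k] : Function.Surjective (wp p : k → k) := fun a => by
  have hP : p.Prime := Fact.out
  have hdeg : (X ^ p - X - C a : k[X]).degree ≠ 0 := by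
    refine fun h => hP.ne_zero ?_
    have h' : (X ^ p - X - C a : k[X]).natDegree = 0 := natDegree_eq_of_degree_eq_some h
    rwa [natDegree_sub_C, FiniteField.X_pow_card_sub_X_natDegree_eq k hP.one_lt] at h'
  obtain ⟨b, hb⟩ := IsAlgClosed.exists_root _ hdeg
  exact ⟨b, by simpa [IsRoot, sub_eq_zero, wp] using hb⟩

/-- The translation formula for all `g_j`, `0 ≤ j ≤ p - 1`, modulo `℘(k[X])`, where `g_0 = S`. The
correction terms `D j` are normalised for `j = 0` and known to be constant for `j = 1`. -/
theorem exists_polyG_comp [IsAlgClosed k] (hp : 3 ≤ p) (y : k) :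
    ∃ D : ℕ → k[X], D 0 = C y ∧ (∃ d, D 1 = C d) ∧ ∀ j < p, (polyG p k j).comp (X + C y) =
      ∑ i ∈ Finset.range (j + 1), C (dividedPow (wp p y) (j - i)) * polyG p k i + wp p (D j) := by
  have h1 : ∀ j, ∃ d : k, wp p d = dividedPow (wp p y) (j + 1) := fun j => wp_surjective _
  choose d hd using h1
  obtain ⟨b, hb⟩ := wp_surjective (p := p) (carry p (y ^ p) (-y))
  refine ⟨fun j => if j = 0 then C y else if j + 1 < p then C (d j) else carry p X (C y) - C b,
    if_pos rfl, ⟨d 1, ?_⟩, fun j hj => ?_⟩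
  · beta_reduce
    rw [if_neg one_ne_zero, if_pos (by omega)]
  · beta_reduce
    rcases Nat.lt_or_ge (j + 1) p with h | h
    · rw [polyG_comp_of_lt h]
      split_ifs with h0
      · subst h0
        rw [← map_wp C, dividedPow_one]
      · rw [← map_wp C, hd]
    · obtain rfl : j = p - 1 := by omega
      rw [if_neg (by omega), if_neg (by omega), polyG_pred_comp hp, wp_sub, ← map_wp C, hb,
        Nat.sub_add_cancel (by omega)]

theorem exists_polyF_eq [IsAlgClosed k] (i : ℕ) :
    ∃ R : k[X], polyG p k i - polyF p k i = wp p R :=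
  (red_spec p (polyG p k i)).2

/-- The `f_i` are independent modulo `℘(k(X))`: since `k[X]` is integrally closed, a relation over
`k(X)` is one over `k[X]`, and there the `f_i` may be replaced by the `g_i`. -/
theorem eq_zero_of_sum_polyF_eq_wp [IsAlgClosed k] (hp : 3 ≤ p) {n : ℕ} (hn : n ≤ p - 1)
    (c : Fin n → ZMod p) (u : RatFunc k)
    (h : wp p u = ∑ i : Fin n, ZMod.castHom dvd_rfl (RatFunc k) (c i) *
      algebraMap k[X] (RatFunc k) (polyF p k (i + 1))) : c = 0 := by
  have hP : p.Prime := Fact.out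
  have h1 : ∑ i : Fin n, ZMod.castHom dvd_rfl (RatFunc k) (c i) *
      algebraMap k[X] (RatFunc k) (polyF p k (i + 1)) = algebraMap k[X] (RatFunc k)
        (∑ i : Fin n, ZMod.castHom dvd_rfl k[X] (c i) * polyF p k (i + 1)) := by
    simp only [map_sum, map_mul, map_zmodCast]
  rw [h1] at h
  set F := ∑ i : Fin n, ZMod.castHom dvd_rfl k[X] (c i) * polyF p k (i + 1)
  have hint : IsIntegral k[X] u := by
    refine ⟨X ^ p - (X + C F), monic_X_pow_sub ?_, ?_⟩
    · rw [degree_X_add_C]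
      exact_mod_cast hP.one_lt
    · simp only [eval₂_sub, eval₂_add, eval₂_X_pow, eval₂_X, eval₂_C, ← h, wp]
      ring
  obtain ⟨P, rfl⟩ := IsIntegrallyClosed.isIntegral_iff.mp hint
  rw [← map_wp] at h
  have h := IsFractionRing.injective k[X] (RatFunc k) h
  choose R hR using exists_polyF_eq (p := p) (k := k)
  have hG : ∑ i : Fin n, C (ZMod.castHom dvd_rfl k (c i)) * polyG p k (i + 1) =
      wp p (P + ∑ i : Fin n, ZMod.castHom dvd_rfl k[X] (c i) * R (i + 1)) := by
    rw [wp_add, h, wp_sum, ← Finset.sum_add_distrib]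
    refine Finset.sum_congr rfl fun i _ => ?_
    rw [wp_castHom_mul, ← hR, map_zmodCast]
    ring
  have hc := eq_zero_of_sum_polyG_eq_wp hp hn hG
  funext i
  exact (ZMod.castHom dvd_rfl k).injective (by simpa using congrFun hc i)

end Polynomials

/-! ### The coordinate ring -/

section Curve

variable {p : ℕ} [Fact p.Prime] {k : Type*} [Field k] [CharP k p] [IsAlgClosed k] {n : ℕ}

/-- The affine curve is integral: its coordinate ring embeds into a separable closure of `k(X)`. -/
theorem isDomain_coordRing (hp : 3 ≤ p) (hn : n ≤ p - 1) : IsDomain (CoordRing p k n) := by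
  let F := RatFunc k
  let L := SeparableClosure F
  have : CharP F p := charP_of_injective_algebraMap (algebraMap k F).injective p
  have : CharP L p := charP_of_injective_algebraMap (algebraMap F L).injective p
  have hinj : Function.Injective (algebraMap k[X] L) := by
    rw [IsScalarTower.algebraMap_eq k[X] F L]
    exact (algebraMap F L).injective.comp (IsFractionRing.injective k[X] F)
  have : FaithfulSMul k[X] L := (faithfulSMul_iff_algebraMap_injective _ _).mpr hinj
  have hw : ∀ i : Fin n, ∃ w : L, wp p w = algebraMap k[X] L (polyF p k (i + 1)) := fun i => by
    set a := algebraMap k[X] L (polyF p k (i + 1))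
    have hdeg : (X ^ p - X - C a : L[X]).degree ≠ 0 := by
      refine fun h => (Fact.out : p.Prime).ne_zero ?_
      have h' : (X ^ p - X - C a : L[X]).natDegree = 0 := natDegree_eq_of_degree_eq_some h
      rwa [natDegree_sub_C,
        FiniteField.X_pow_card_sub_X_natDegree_eq L (Fact.out : p.Prime).one_lt] at h'
    have hsep : (X ^ p - X - C a : L[X]).Separable := by
      refine ⟨0, -1, ?_⟩
      simp only [derivative_sub, derivative_X_pow, derivative_X, derivative_C,
        CharP.cast_eq_zero, C_0]
      ring
    obtain ⟨w, hw⟩ := IsSepClosed.exists_root (X ^ p - X - C a) hdeg hsep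
    exact ⟨w, by simpa [IsRoot, sub_eq_zero, wp] using hw⟩
  choose w hw using hw
  let J : Ideal (MvPolynomial (Fin n) k[X]) :=
    RingHom.ker (MvPolynomial.aeval w : MvPolynomial (Fin n) k[X] →ₐ[k[X]] L)
  have hJ : J.IsPrime := RingHom.ker_isPrime _
  let e := MvPolynomial.optionEquivRight k (Fin n)
  let I : Ideal (MvPolynomial (Option (Fin n)) k) := Ideal.span (Set.range fun j : Fin n =>
      wp p (MvPolynomial.X (some j) : MvPolynomial (Option (Fin n)) k)
        - Polynomial.aeval (MvPolynomial.X none) (polyF p k (j + 1)))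
  have heI : I.map e = J := by
    have hgen : ∀ j : Fin n, e (wp p (MvPolynomial.X (some j) : MvPolynomial (Option (Fin n)) k)
        - Polynomial.aeval (MvPolynomial.X none) (polyF p k (j + 1))) =
        wp p (MvPolynomial.X j) - MvPolynomial.C (polyF p k (j + 1)) := fun j => by
      have h1 : e (MvPolynomial.X (some j)) = MvPolynomial.X j :=
        MvPolynomial.optionEquivRight_X_some _ _ _
      have h2 : e (MvPolynomial.X none) = MvPolynomial.C X :=
        MvPolynomial.optionEquivRight_X_none _ _
      have h3 : e (Polynomial.aeval (MvPolynomial.X none) (polyF p k (j + 1))) =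
          MvPolynomial.C (polyF p k (j + 1)) := by
        rw [← Polynomial.aeval_algHom_apply, h2]
        have := Polynomial.aeval_algHom_apply
          (IsScalarTower.toAlgHom k k[X] (MvPolynomial (Fin n) k[X])) X (polyF p k (j + 1))
        rw [Polynomial.aeval_X_left_apply] at this
        exact this
      rw [map_sub, h3]
      simp only [wp, map_sub, map_pow, h1]
    rw [Ideal.map_span, ← Set.range_comp]
    refine le_antisymm ?_ fun P hP => ?_
    · rw [Ideal.span_le]
      rintro _ ⟨j, rfl⟩
      rw [Function.comp_apply, hgen, SetLike.mem_coe, RingHom.mem_ker]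
      simp only [map_sub, MvPolynomial.aeval_C, ← hw]
      simp [wp]
    · have := mem_span_of_aeval_eq_zero (F := F) hw (eq_zero_of_sum_polyF_eq_wp hp hn) hP
      convert! this using 3
      exact funext hgen
  have hI : I = Ideal.comap e J := by
    rw [← heI, Ideal.comap_map_of_bijective _ e.bijective]
  have : I.IsPrime := hI ▸ Ideal.comap_isPrime _ _
  exact Ideal.Quotient.isDomain I

theorem coordRing_charP (hp : 3 ≤ p) (hn : n ≤ p - 1) : CharP (CoordRing p k n) p :=
  have := isDomain_coordRing (k := k) hp hn
  charP_of_injective_algebraMap (algebraMap k (CoordRing p k n)).injective p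

theorem funField_charP (hp : 3 ≤ p) (hn : n ≤ p - 1) : CharP (FunField p k n) p :=
  have := isDomain_coordRing (k := k) hp hn
  charP_of_injective_algebraMap (algebraMap k (FunField p k n)).injective p

variable (p k n) in
/-- The class of `X` in the coordinate ring. -/
noncomputable def coordX : CoordRing p k n := Ideal.Quotient.mk _ (MvPolynomial.X none)

/-- The class of `W_{j+1}` in the coordinate ring. -/
noncomputable def coordV (j : Fin n) : CoordRing p k n :=
  Ideal.Quotient.mk _ (MvPolynomial.X (some j))

theorem wp_coordV (j : Fin n) :
    wp p (coordV j : CoordRing p k n) = aeval (coordX p k n) (polyF p k (j + 1)) := by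
  have h : (Ideal.Quotient.mk _ (wp p (MvPolynomial.X (some j)) -
      aeval (MvPolynomial.X none) (polyF p k (j + 1))) : CoordRing p k n) = 0 :=
    Ideal.Quotient.eq_zero_iff_mem.mpr (Ideal.subset_span ⟨j, rfl⟩)
  rw [map_sub, map_wp, sub_eq_zero] at h
  refine h.trans ?_
  exact (aeval_algHom_apply (Ideal.Quotient.mkₐ k _) _ _).symm

theorem exists_coordRing_hom_of_wp_eq_polyF {B : Type*} [CommRing B] [Algebra k B] (x : B)
    (v : Fin n → B) (hv : ∀ j, wp p (v j) = aeval x (polyF p k (j + 1))) :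
    ∃ θ : CoordRing p k n →ₐ[k] B, θ (coordX p k n) = x ∧ ∀ j, θ (coordV j) = v j := by
  let θ : MvPolynomial (Option (Fin n)) k →ₐ[k] B := MvPolynomial.aeval fun o => o.elim x v
  have hθ0 : θ (MvPolynomial.X none) = x := MvPolynomial.aeval_X _ _
  have hθ1 : ∀ j, θ (MvPolynomial.X (some j)) = v j := fun j => MvPolynomial.aeval_X _ _
  have hθ : ∀ P ∈ Ideal.span (Set.range fun j : Fin n =>
      wp p (MvPolynomial.X (some j) : MvPolynomial (Option (Fin n)) k)
        - aeval (MvPolynomial.X none) (polyF p k (j + 1))), θ P = 0 := by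
    intro P hP
    rw [← RingHom.mem_ker]
    refine (Ideal.span_le.mpr ?_) hP
    rintro _ ⟨j, rfl⟩
    rw [SetLike.mem_coe, RingHom.mem_ker, map_sub, ← aeval_algHom_apply, hθ0, ← hv, ← hθ1, wp, wp,
      map_sub, map_pow, sub_self]
  exact ⟨Ideal.Quotient.liftₐ _ θ hθ, hθ0, hθ1⟩

variable (p k) in
/-- A polynomial `R_i` with `g_i - f_i = ℘(R_i)`. -/
noncomputable def polyR (i : ℕ) : k[X] := (exists_polyF_eq (p := p) (k := k) i).choose

theorem polyG_sub_polyF (i : ℕ) : polyG p k i - polyF p k i = wp p (polyR p k i) :=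
  (exists_polyF_eq i).choose_spec

theorem aeval_wp {B : Type*} [CommRing B] [Algebra k B] (x : B) (P : k[X]) :
    aeval x (wp p P) = wp p (aeval x P) := by
  simp [wp]

theorem wp_aeval_polyR {B : Type*} [CommRing B] [Algebra k B] (x : B) (i : ℕ) :
    wp p (aeval x (polyR p k i)) = aeval x (polyG p k i) - aeval x (polyF p k i) := by
  rw [← map_sub, polyG_sub_polyF, aeval_wp]

variable (p k n) in
/-- Generators `w_0 = X` and `w_j = W_j + R_j(X)`, `1 ≤ j ≤ n`, of the coordinate ring, adapted to
the `g_j` instead of the `f_j`: `℘(w_j) = g_j(X)` for all `0 ≤ j ≤ n`, where `g_0 = S`. The value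
for `j > n` is irrelevant. -/
noncomputable def coordW : ℕ → CoordRing p k n
  | 0 => coordX p k n
  | j + 1 => if h : j < n then coordV ⟨j, h⟩ + aeval (coordX p k n) (polyR p k (j + 1)) else 0

theorem coordW_zero : coordW p k n 0 = coordX p k n := rfl

theorem coordW_succ (j : Fin n) :
    coordW p k n (j + 1) = coordV j + aeval (coordX p k n) (polyR p k (j + 1)) :=
  dif_pos j.2

theorem wp_coordW (hp : 3 ≤ p) [CharP (CoordRing p k n) p] {j : ℕ} (hj : j ≤ n) :
    wp p (coordW p k n j) = aeval (coordW p k n 0) (polyG p k j) := by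
  rcases j with _ | j
  · rw [polyG_zero hp]
    simp [polyS, wp]
  · rw [coordW_succ ⟨j, hj⟩, coordW_zero, wp_add_char, wp_coordV, wp_aeval_polyR]
    ring

theorem coordRing_hom_ext {B : Type*} [CommRing B] [Algebra k B] {θ η : CoordRing p k n →ₐ[k] B}
    (h : ∀ j ≤ n, θ (coordW p k n j) = η (coordW p k n j)) : θ = η := by
  have h0 : θ (coordX p k n) = η (coordX p k n) := h 0 (Nat.zero_le _)
  refine Ideal.Quotient.algHom_ext _ (MvPolynomial.algHom_ext fun o => ?_)
  rcases o with _ | j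
  · exact h0
  · have hj := h (j + 1) j.2
    rw [coordW_succ, map_add, map_add, ← aeval_algHom_apply, ← aeval_algHom_apply, h0] at hj
    exact add_right_cancel hj

theorem exists_coordRing_hom {B : Type*} [CommRing B] [Algebra k B] [CharP B p] (v : ℕ → B)
    (hv : ∀ j ≤ n, wp p (v j) = aeval (v 0) (polyG p k j)) :
    ∃ θ : CoordRing p k n →ₐ[k] B, ∀ j ≤ n, θ (coordW p k n j) = v j := by
  obtain ⟨θ, hθ0, hθ⟩ := exists_coordRing_hom_of_wp_eq_polyF (p := p) (n := n) (v 0)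
    (fun j => v (j + 1) - aeval (v 0) (polyR p k (j + 1))) fun j => by
      rw [wp_sub_char, hv _ j.2, wp_aeval_polyR]
      ring
  refine ⟨θ, fun j hj => ?_⟩
  rcases j with _ | j
  · exact hθ0
  · rw [coordW_succ ⟨j, hj⟩, map_add, hθ, ← aeval_algHom_apply, hθ0]
    exact sub_add_cancel _ _

theorem exists_const_of_wp_eq {B : Type*} [CommRing B] [IsDomain B] [Algebra k B] {a b : B}
    (h : wp p a = wp p b) : ∃ c : k, c ^ p = c ∧ a = b + algebraMap k B c := by
  let F := FractionRing B
  have : CharP F p := charP_of_injective_algebraMap (algebraMap k F).injective p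
  obtain ⟨z, hz⟩ := exists_zmod_of_wp_eq (p := p) (a := algebraMap B F a) (b := algebraMap B F b)
    (by rw [← map_wp, h, map_wp])
  refine ⟨ZMod.castHom dvd_rfl k z, by rw [← map_pow, ZMod.pow_card],
    IsFractionRing.injective B F ?_⟩
  rw [hz, map_add, ← IsScalarTower.algebraMap_apply, map_zmodCast]

section Shift

variable {B : Type*} [CommRing B] [Algebra k B]

/-- The linear unipotent substitution `w_j ↦ ∑_{i ≤ j} s ^ (j - i) / (j - i)! * w_i + D_j(w_0)`,
which is the action of a translation `X ↦ X + y` with `S(y) = s` on solutions of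
`℘(w_j) = g_j(w_0)`, up to constants in `F_p`. -/
noncomputable def shift (s : k) (D : ℕ → k[X]) (w : ℕ → B) (j : ℕ) : B :=
  ∑ i ∈ Finset.range (j + 1), algebraMap k B (dividedPow s (j - i)) * w i + aeval (w 0) (D j)

theorem map_shift {B' E : Type*} [CommRing B'] [Algebra k B'] [FunLike E B B']
    [AlgHomClass E k B B'] (θ : E) (s : k) (D : ℕ → k[X]) (w : ℕ → B) (j : ℕ) :
    θ (shift s D w j) = shift s D (fun i => θ (w i)) j := by
  simp only [shift, map_add, map_sum, map_mul, AlgHomClass.commutes, aeval_algHom_apply]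

theorem shift_congr {s : k} {D : ℕ → k[X]} {w w' : ℕ → B} {j : ℕ} (h : ∀ i ≤ j, w i = w' i) :
    shift s D w j = shift s D w' j := by
  rw [shift, shift, h 0 (Nat.zero_le _)]
  congr 1
  refine Finset.sum_congr rfl fun i hi => ?_
  rw [h i (Nat.lt_succ_iff.mp (Finset.mem_range.mp hi))]

theorem wp_algebraMap_eq_zero {c : k} (hc : c ^ p = c) : wp p (algebraMap k B c) = 0 := by
  rw [← map_wp, wp, hc, sub_self, map_zero]

theorem wp_shift [CharP B p] {y : k} (hy : y ∈ zerosQ p k) {D : ℕ → k[X]}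
    {w : ℕ → B} {j : ℕ} (hD : (polyG p k j).comp (X + C y) =
      ∑ i ∈ Finset.range (j + 1), C (dividedPow (wp p y) (j - i)) * polyG p k i + wp p (D j))
    (hw : ∀ i ≤ j, wp p (w i) = aeval (w 0) (polyG p k i)) :
    wp p (shift (wp p y) D w j) = aeval (w 0 + algebraMap k B y) (polyG p k j) := by
  have hs : (wp p y) ^ p = wp p y := by
    have : (polyQ p k).eval y = 0 := hy
    rw [eval_polyQ] at this
    exact sub_eq_zero.mp this
  have h1 := congrArg (aeval (w 0)) hD
  rw [aeval_comp, map_add, map_add, map_sum, aeval_X, aeval_C] at h1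
  rw [h1, shift, wp_add_char, wp_sum]
  congr 1
  · refine Finset.sum_congr rfl fun i hi => ?_
    rw [Finset.mem_range] at hi
    rw [map_mul, aeval_C, ← hw i (by omega)]
    have hd := dividedPow_pow hs (j - i)
    generalize dividedPow (wp p y) (j - i) = d at hd ⊢
    simp only [wp, mul_pow, ← map_pow, hd]
    ring
  · rw [aeval_wp]

theorem shift_zero {s : k} {D : ℕ → k[X]} {y : k} (hD : D 0 = C y) (w : ℕ → B) :
    shift s D w 0 = w 0 + algebraMap k B y := by
  simp [shift, hD, dividedPow_zero]

theorem shift_one {s : k} {D : ℕ → k[X]} {d : k} (hD : D 1 = C d) (w : ℕ → B) :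
    shift s D w 1 = algebraMap k B s * w 0 + w 1 + algebraMap k B d := by
  simp [shift, hD, dividedPow_zero, dividedPow_one, Finset.sum_range_succ]

/-- The substitution sees a translation of the `w_i` by constants linearly, as long as the argument
`w_0` of the polynomials `D_j` does not move. -/
theorem shift_add_const {s : k} {D : ℕ → k[X]} (w : ℕ → B) {c : ℕ → k} (hc : c 0 = 0) (j : ℕ) :
    shift s D (fun i => w i + algebraMap k B (c i)) j = shift s D w j +
      algebraMap k B (∑ i ∈ Finset.range (j + 1), dividedPow s (j - i) * c i) := by
  simp only [shift, hc, map_zero, add_zero, mul_add, Finset.sum_add_distrib, map_sum, map_mul]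
  ring

end Shift

end Curve

/-! ### The group `G[n]` and its center -/

section Group

variable {p : ℕ} [Fact p.Prime] {k : Type*} [Field k] [CharP k p] [IsAlgClosed k] {n : ℕ}

/-- An endomorphism fixing `X` moves each `w_j` by a constant, so it has an evident inverse. -/
theorem bijective_of_apply_coordX_eq (hp : 3 ≤ p) (hn : n ≤ p - 1)
    (θ : CoordRing p k n →ₐ[k] CoordRing p k n) (hθ : θ (coordX p k n) = coordX p k n) :
    Function.Bijective θ := by
  have := isDomain_coordRing (k := k) hp hn
  have := coordRing_charP (k := k) hp hn
  have h1 : ∀ j, ∃ c : k, (j ≤ n → c ^ p = c ∧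
      θ (coordW p k n j) = coordW p k n j + algebraMap k _ c) ∧ (j = 0 → c = 0) := by
    intro j
    rcases eq_or_ne j 0 with rfl | hj0
    · exact ⟨0, fun _ => ⟨zero_pow (Fact.out : p.Prime).ne_zero, by
        rw [map_zero, add_zero]; exact hθ⟩, fun _ => rfl⟩
    rcases le_or_gt j n with hj | hj
    · obtain ⟨c, hc⟩ := exists_const_of_wp_eq (p := p) (k := k) (a := θ (coordW p k n j))
        (b := coordW p k n j) (by
          rw [← map_wp, wp_coordW hp hj,
            ← aeval_algHom_apply, coordW_zero, hθ])
      exact ⟨c, fun _ => hc, fun h => absurd h hj0⟩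
    · exact ⟨0, fun h => by omega, fun h => rfl⟩
  choose c hc hc0 using h1
  obtain ⟨η, hη⟩ := exists_coordRing_hom (p := p) (k := k) (n := n)
    (fun j => coordW p k n j - algebraMap k _ (c j)) fun j hj => by
      rw [wp_sub_char, wp_algebraMap_eq_zero (hc j hj).1, hc0 0 rfl, map_zero, sub_zero, sub_zero,
        wp_coordW hp hj]
  have h1 : θ.comp η = AlgHom.id k _ := coordRing_hom_ext fun j hj => by
    rw [AlgHom.comp_apply, hη j hj, map_sub, (hc j hj).2, AlgHom.commutes, AlgHom.id_apply,
      add_sub_cancel_right]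
  have h2 : η.comp θ = AlgHom.id k _ := coordRing_hom_ext fun j hj => by
    rw [AlgHom.comp_apply, (hc j hj).2, map_add, hη j hj, AlgHom.commutes, AlgHom.id_apply,
      sub_add_cancel]
  exact ⟨(Function.LeftInverse.injective (g := η) fun a => AlgHom.congr_fun h2 a),
    (Function.RightInverse.surjective (g := η) fun a => AlgHom.congr_fun h1 a)⟩

theorem exists_coordRing_translate (hp : 3 ≤ p) (hn : n ≤ p - 1) {y : k} (hy : y ∈ zerosQ p k) :
    ∃ θ : CoordRing p k n →ₐ[k] CoordRing p k n,
      θ (coordX p k n) = coordX p k n + algebraMap k _ y := by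
  have := coordRing_charP (k := k) hp hn
  obtain ⟨D, hD0, -, hD⟩ := exists_polyG_comp hp y
  obtain ⟨θ, hθ⟩ := exists_coordRing_hom (p := p) (k := k) (n := n)
    (shift (wp p y) D (coordW p k n)) fun j hj => by
      rw [shift_zero hD0]
      exact wp_shift hy (hD j (by omega)) fun i hi => wp_coordW hp (hi.trans hj)
  exact ⟨θ, by rw [← coordW_zero, hθ 0 (Nat.zero_le _), shift_zero hD0]⟩

/-- Endomorphisms above opposite translations of `X` compose to endomorphisms fixing `X`. -/
theorem bijective_of_apply_coordX_eq_add (hp : 3 ≤ p) (hn : n ≤ p - 1) {y : k}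
    (hy : y ∈ zerosQ p k) (θ : CoordRing p k n →ₐ[k] CoordRing p k n)
    (hθ : θ (coordX p k n) = coordX p k n + algebraMap k _ y) : Function.Bijective θ := by
  obtain ⟨η, hη⟩ := exists_coordRing_translate (k := k) hp hn (neg_mem hy)
  have h1 := bijective_of_apply_coordX_eq hp hn (θ.comp η) (by
    rw [AlgHom.comp_apply, hη, map_add, hθ, AlgHom.commutes, map_neg, add_neg_cancel_right])
  have h2 := bijective_of_apply_coordX_eq hp hn (η.comp θ) (by
    rw [AlgHom.comp_apply, hθ, map_add, hη, AlgHom.commutes, map_neg, neg_add_cancel_right])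
  exact ⟨Function.Injective.of_comp (f := η) h2.1, Function.Surjective.of_comp (g := η) h1.2⟩

variable (p k n) in
/-- The adapted generators `w_j` in the function field. -/
noncomputable def genW (j : ℕ) : FunField p k n := algebraMap (CoordRing p k n) _ (coordW p k n j)

theorem genW_zero : genW p k n 0 = funX p k n := rfl

theorem genW_succ (j : Fin n) :
    genW p k n (j + 1) = funW p k n j + aeval (funX p k n) (polyR p k (j + 1)) := by
  rw [genW, coordW_succ, map_add]
  congr 1
  exact (aeval_algebraMap_apply _ _ _).symm

theorem wp_genW (hp : 3 ≤ p) (hn : n ≤ p - 1) {j : ℕ} (hj : j ≤ n) :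
    wp p (genW p k n j) = aeval (genW p k n 0) (polyG p k j) := by
  have := coordRing_charP (k := k) hp hn
  rw [genW, ← map_wp, wp_coordW hp hj, genW, aeval_algebraMap_apply]

theorem funField_aut_ext (hp : 3 ≤ p) (hn : n ≤ p - 1)
    {σ τ : FunField p k n ≃ₐ[k] FunField p k n}
    (h : ∀ j ≤ n, σ (genW p k n j) = τ (genW p k n j)) : σ = τ := by
  have := isDomain_coordRing (k := k) hp hn
  let ι : CoordRing p k n →ₐ[k] FunField p k n := IsScalarTower.toAlgHom k _ _
  have h1 : (σ : FunField p k n →ₐ[k] FunField p k n).comp ι =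
      (τ : FunField p k n →ₐ[k] FunField p k n).comp ι := coordRing_hom_ext h
  have h2 : (σ : FunField p k n →+* FunField p k n) = τ :=
    IsLocalization.ringHom_ext (nonZeroDivisors (CoordRing p k n))
      (RingHom.ext fun a => AlgHom.congr_fun h1 a)
  exact AlgEquiv.ext fun a => RingHom.congr_fun h2 a

/-- Every solution `v` of the defining equations above a translation of `X` by an element of `V` is
the image of the generators under an automorphism. -/
theorem exists_funField_aut (hp : 3 ≤ p) (hn : n ≤ p - 1) {y : k} (hy : y ∈ zerosQ p k)
    (v : ℕ → CoordRing p k n) (hv0 : v 0 = coordX p k n + algebraMap k _ y)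
    (hv : ∀ j ≤ n, wp p (v j) = aeval (v 0) (polyG p k j)) :
    ∃ σ : FunField p k n ≃ₐ[k] FunField p k n, ∀ j ≤ n, σ (genW p k n j) = algebraMap _ _ (v j) := by
  have := coordRing_charP (k := k) hp hn
  obtain ⟨θ, hθ⟩ := exists_coordRing_hom v hv
  have hb := bijective_of_apply_coordX_eq_add hp hn hy θ ((hθ 0 (Nat.zero_le _)).trans hv0)
  refine ⟨IsFractionRing.algEquivOfAlgEquiv (AlgEquiv.ofBijective θ hb), fun j hj => ?_⟩
  rw [genW, IsFractionRing.algEquivOfAlgEquiv_algebraMap, AlgEquiv.ofBijective_apply, hθ j hj]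

theorem exists_aut_add_const (hp : 3 ≤ p) (hn : n ≤ p - 1) {c : ℕ → k} (hc0 : c 0 = 0)
    (hc : ∀ j, c j ^ p = c j) :
    ∃ σ : FunField p k n ≃ₐ[k] FunField p k n,
      ∀ j ≤ n, σ (genW p k n j) = genW p k n j + algebraMap k _ (c j) := by
  have := coordRing_charP (k := k) hp hn
  obtain ⟨σ, hσ⟩ := exists_funField_aut hp hn (zero_mem (zerosQ p k))
    (fun j => coordW p k n j + algebraMap k _ (c j)) (by rw [hc0]; rfl) fun j hj => by
      rw [wp_add_char, wp_algebraMap_eq_zero (hc j), hc0, map_zero, add_zero, add_zero,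
        wp_coordW hp hj]
  refine ⟨σ, fun j hj => ?_⟩
  rw [hσ j hj, map_add, genW, ← IsScalarTower.algebraMap_apply]

theorem exists_mem_groupG (hp : 3 ≤ p) (hn : n ≤ p - 1) {y : k} (hy : y ∈ zerosQ p k) :
    ∃ σ ∈ groupG p k n, σ (funX p k n) = funX p k n + algebraMap k _ y := by
  have := coordRing_charP (k := k) hp hn
  obtain ⟨D, hD0, -, hD⟩ := exists_polyG_comp hp y
  obtain ⟨σ, hσ⟩ := exists_funField_aut hp hn hy
    (shift (wp p y) D (coordW p k n)) (shift_zero hD0 _) fun j hj => by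
      rw [shift_zero hD0]
      exact wp_shift hy (hD j (by omega)) fun i hi => wp_coordW hp (hi.trans hj)
  have h : σ (funX p k n) = funX p k n + algebraMap k _ y := by
    rw [← genW_zero, hσ 0 (Nat.zero_le _), shift_zero hD0, map_add, genW,
      ← IsScalarTower.algebraMap_apply]
  exact ⟨σ, ⟨y, hy, h⟩, h⟩

theorem exists_apply_genW_eq (hp : 3 ≤ p) (hn : n ≤ p - 1) {y : k} (hy : y ∈ zerosQ p k)
    {D : ℕ → k[X]} (hD : ∀ j < p, (polyG p k j).comp (X + C y) =
      ∑ i ∈ Finset.range (j + 1), C (dividedPow (wp p y) (j - i)) * polyG p k i + wp p (D j))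
    {σ : FunField p k n ≃ₐ[k] FunField p k n}
    (hσ : σ (funX p k n) = funX p k n + algebraMap k _ y) {j : ℕ} (hj : j ≤ n) :
    ∃ c : k, c ^ p = c ∧
      σ (genW p k n j) = shift (wp p y) D (genW p k n) j + algebraMap k _ c := by
  have := isDomain_coordRing (k := k) hp hn
  have := funField_charP (k := k) hp hn
  refine exists_const_of_wp_eq ?_
  rw [wp_shift hy (hD j (by omega)) fun i hi => wp_genW hp hn (hi.trans hj),
    ← map_wp, wp_genW hp hn hj,
    ← aeval_algHom_apply, genW_zero, hσ]

theorem exists_apply_genW_eq_add (hp : 3 ≤ p) (hn : n ≤ p - 1)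
    {σ : FunField p k n ≃ₐ[k] FunField p k n} (hσ : σ (funX p k n) = funX p k n) {j : ℕ}
    (hj : j ≤ n) :
    ∃ c : k, c ^ p = c ∧ σ (genW p k n j) = genW p k n j + algebraMap k _ c := by
  have := isDomain_coordRing (k := k) hp hn
  refine exists_const_of_wp_eq ?_
  rw [← map_wp, wp_genW hp hn hj,
    ← aeval_algHom_apply, genW_zero, hσ]

/-- The commutator pairing `(y, z) ↦ S(z) * y - S(y) * z` of `V`, read off from the action on
`w_1 ↦ w_1 + S(y) * X + b` with `b` constant, vanishes on commuting elements. -/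
theorem wp_mul_eq_of_commute (hp : 3 ≤ p) (hn1 : 1 ≤ n) (hn : n ≤ p - 1) {y z : k}
    (hy : y ∈ zerosQ p k) (hz : z ∈ zerosQ p k) {σ τ : FunField p k n ≃ₐ[k] FunField p k n}
    (hσ : σ (funX p k n) = funX p k n + algebraMap k _ y)
    (hτ : τ (funX p k n) = funX p k n + algebraMap k _ z) (hcomm : σ * τ = τ * σ) :
    wp p z * y = wp p y * z := by
  have := isDomain_coordRing (k := k) hp hn
  have key : ∀ {y : k}, y ∈ zerosQ p k → ∀ {σ : FunField p k n ≃ₐ[k] FunField p k n},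
      σ (funX p k n) = funX p k n + algebraMap k _ y → ∃ b : k, σ (genW p k n 1) =
        algebraMap k _ (wp p y) * funX p k n + genW p k n 1 + algebraMap k _ b := by
    intro y hy σ hσ
    obtain ⟨D, -, ⟨d, hd⟩, hD⟩ := exists_polyG_comp hp y
    obtain ⟨c, -, hc⟩ := exists_apply_genW_eq hp hn hy hD hσ hn1
    refine ⟨d + c, ?_⟩
    rw [hc, shift_one hd, genW_zero, map_add]
    ring
  obtain ⟨b, hb⟩ := key hy hσ
  obtain ⟨e, he⟩ := key hz hτ
  have h := AlgEquiv.congr_fun hcomm (genW p k n 1)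
  simp only [AlgEquiv.mul_apply, hb, he, map_add, map_mul, AlgEquiv.commutes, hσ, hτ] at h
  apply (algebraMap k (FunField p k n)).injective
  rw [map_mul, map_mul]
  linear_combination h

theorem wp_mem_zerosQ {z : k} (hz : wp p z = 0 ∨ wp p z = 1) : z ∈ zerosQ p k := by
  have hp0 : p ≠ 0 := (Fact.out : p.Prime).ne_zero
  change (polyQ p k).eval z = 0
  rw [eval_polyQ]
  change (wp p z) ^ p - wp p z = 0
  rcases hz with h | h
  · rw [h, zero_pow hp0, sub_self]
  · rw [h, one_pow, sub_self]

/-- The center consists of the elements fixing `w_0 = X` and `w_1, …, w_{n-1}`. -/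
theorem mem_center_iff (hp : 3 ≤ p) (hn1 : 1 ≤ n) (hn : n ≤ p - 1) (σ : groupG p k n) :
    σ ∈ Subgroup.center (groupG p k n) ↔ ∀ j < n, σ.1 (genW p k n j) = genW p k n j := by
  have := isDomain_coordRing (k := k) hp hn
  rw [Subgroup.mem_center_iff]
  constructor
  · intro hσ
    have hcomm : ∀ τ ∈ groupG p k n, σ.1 * τ = τ * σ.1 := fun τ hτ =>
      (congrArg Subtype.val (hσ ⟨τ, hτ⟩)).symm
    obtain ⟨y, hy, hσy⟩ := σ.2
    have h1 : wp p (1 : k) = 0 := by simp [wp]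
    -- The pairing with `z = 1`, for which `S(z) = 0`, gives `S(y) = 0`.
    have hy0 : wp p y = 0 := by
      obtain ⟨τ, hτ, hτ1⟩ := exists_mem_groupG (k := k) hp hn (wp_mem_zerosQ (Or.inl h1))
      have := wp_mul_eq_of_commute hp hn1 hn hy (wp_mem_zerosQ (Or.inl h1)) hσy hτ1 (hcomm τ hτ)
      simpa [h1] using this.symm
    -- The pairing with some `z` for which `S(z) = 1` then gives `y = 0`.
    obtain ⟨z, hz⟩ := wp_surjective (p := p) (1 : k)
    have hzV : z ∈ zerosQ p k := wp_mem_zerosQ (Or.inr hz)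
    obtain ⟨τ, hτ, hτz⟩ := exists_mem_groupG (k := k) hp hn hzV
    have hyz : y = 0 := by
      simpa [hz, hy0] using wp_mul_eq_of_commute hp hn1 hn hy hzV hσy hτz (hcomm τ hτ)
    rw [hyz, map_zero, add_zero] at hσy
    have hc : ∀ j, ∃ c : k, (j ≤ n → σ.1 (genW p k n j) = genW p k n j + algebraMap k _ c) ∧
        (j = 0 → c = 0) := fun j => by
      rcases eq_or_ne j 0 with rfl | hj0
      · exact ⟨0, fun _ => by rw [genW_zero, hσy, map_zero, add_zero], fun _ => rfl⟩
      by_cases hj : j ≤ n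
      · obtain ⟨c, -, hc⟩ := exists_apply_genW_eq_add hp hn hσy hj
        exact ⟨c, fun _ => hc, fun h => absurd h hj0⟩
      · exact ⟨0, fun h => absurd h hj, fun _ => rfl⟩
    choose c hc hc0 using hc
    obtain ⟨D, -, -, hD⟩ := exists_polyG_comp hp z
    -- Commutation with a lift of this `z` yields a triangular system for the constants `c j`.
    have hsum : ∀ j ≤ n, ∑ i ∈ Finset.range j, dividedPow (1 : k) (j - i) * c i = 0 := by
      intro j hj
      obtain ⟨d, -, hd⟩ := exists_apply_genW_eq hp hn hzV hD hτz hj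
      have h := AlgEquiv.congr_fun (hcomm τ hτ) (genW p k n j)
      rw [AlgEquiv.mul_apply, AlgEquiv.mul_apply, hc j hj, hd, map_add, map_add,
        AlgEquiv.commutes, AlgEquiv.commutes, hd, map_shift,
        shift_congr fun i hi => hc i (hi.trans hj)] at h
      rw [shift_add_const _ (hc0 0 rfl), Finset.sum_range_succ, Nat.sub_self, dividedPow_zero,
        one_mul, hz] at h
      apply (algebraMap k (FunField p k n)).injective
      rw [map_zero]
      rw [map_add] at h
      linear_combination h
    have hczero : ∀ j, j < n → c j = 0 := by
      intro j
      induction j using Nat.strong_induction_on with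
      | _ j ih =>
        intro hj
        have h := hsum (j + 1) hj
        rw [Finset.sum_range_succ, Finset.sum_eq_zero fun i hi => by
          rw [Finset.mem_range] at hi
          rw [ih i hi (by omega), mul_zero], zero_add, Nat.add_sub_cancel_left, dividedPow_one,
          one_mul] at h
        exact h
    intro j hj
    rw [hc j hj.le, hczero j hj, map_zero, add_zero]
  · intro hσ τ
    refine Subtype.ext (funField_aut_ext hp hn fun j hj => ?_)
    obtain ⟨z, hz, hτz⟩ := τ.2
    have hσX : σ.1 (funX p k n) = funX p k n := hσ 0 hn1
    obtain ⟨D, -, -, hD⟩ := exists_polyG_comp hp z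
    obtain ⟨d, -, hd⟩ := exists_apply_genW_eq hp hn hz hD hτz hj
    obtain ⟨c, -, hc⟩ := exists_apply_genW_eq_add hp hn hσX hj
    let e : ℕ → k := fun i => if i = j then c else 0
    have he0 : e 0 = 0 := by
      by_cases h0 : 0 = j
      · subst h0
        rw [genW_zero, hσX, left_eq_add] at hc
        simpa [e] using hc
      · exact if_neg h0
    have he : ∀ i ≤ j, σ.1 (genW p k n i) = genW p k n i + algebraMap k _ (e i) := fun i hi => by
      rcases hi.lt_or_eq with hi | rfl
      · simp only [e]
        rw [hσ i (hi.trans_le hj), if_neg hi.ne, map_zero, add_zero]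
      · simp only [e, if_true, hc]
    have hsum : ∑ i ∈ Finset.range (j + 1), dividedPow (wp p z) (j - i) * e i = c := by
      rw [Finset.sum_range_succ, Finset.sum_eq_zero fun i hi => by
        rw [Finset.mem_range] at hi
        simp only [e]
        rw [if_neg hi.ne, mul_zero]]
      simp [e, dividedPow_zero]
    change τ.1 (σ.1 (genW p k n j)) = σ.1 (τ.1 (genW p k n j))
    rw [hc, map_add, hd, map_add, map_shift, shift_congr he, shift_add_const _ he0, hsum,
      AlgEquiv.commutes, AlgEquiv.commutes]
    ring

theorem card_center (hp : 3 ≤ p) (hn1 : 1 ≤ n) (hn : n ≤ p - 1) :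
    Nat.card (Subgroup.center (groupG p k n)) = p := by
  have := isDomain_coordRing (k := k) hp hn
  have h : ∀ σ : Subgroup.center (groupG p k n), ∃ c : (⊥ : Subfield k),
      σ.1.1 (genW p k n n) = genW p k n n + algebraMap k _ c.1 := fun σ => by
    have hσ := (mem_center_iff hp hn1 hn σ.1).mp σ.2
    obtain ⟨c, hc, h⟩ := exists_apply_genW_eq_add hp hn (hσ 0 hn1) le_rfl
    exact ⟨⟨c, (Subfield.mem_bot_iff_pow_eq_self k p).mpr hc⟩, h⟩
  choose c hc using h
  refine (Nat.card_eq_of_bijective c ⟨fun σ τ h => ?_, fun a => ?_⟩).trans (Subfield.card_bot k p)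
  · refine Subtype.ext (Subtype.ext (funField_aut_ext hp hn fun j hj => ?_))
    rcases hj.lt_or_eq with hj | rfl
    · rw [(mem_center_iff hp hn1 hn σ.1).mp σ.2 j hj, (mem_center_iff hp hn1 hn τ.1).mp τ.2 j hj]
    · rw [hc, hc, h]
  · have ha := (Subfield.mem_bot_iff_pow_eq_self k p).mp a.2
    obtain ⟨σ, hσ⟩ := exists_aut_add_const (k := k) hp hn (c := fun j => if j = n then a.1 else 0)
      (if_neg (by omega)) fun j => by
        split_ifs
        exacts [ha, zero_pow (Fact.out : p.Prime).ne_zero]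
    have hσ' : ∀ j < n, σ (genW p k n j) = genW p k n j := fun j hj => by
      rw [hσ j hj.le, if_neg hj.ne, map_zero, add_zero]
    have hG : σ ∈ groupG p k n := ⟨0, zero_mem _, by
      rw [map_zero, add_zero]
      exact hσ' 0 hn1⟩
    refine ⟨⟨⟨σ, hG⟩, (mem_center_iff hp hn1 hn ⟨σ, hG⟩).mpr hσ'⟩, Subtype.ext ?_⟩
    apply (algebraMap k (FunField p k n)).injective
    have h := (hc ⟨⟨σ, hG⟩, (mem_center_iff hp hn1 hn ⟨σ, hG⟩).mpr hσ'⟩).symm.trans (hσ n le_rfl)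
    rw [if_pos rfl] at h
    exact add_left_cancel h

end Group

end BigAction

theorem proposition6p5 (p : ℕ) [Fact p.Prime] (hp : 3 ≤ p)
    (k : Type*) [Field k] [CharP k p] [IsAlgClosed k]
    (n : ℕ) (hn : 1 ≤ n) (hnp : n ≤ p - 1) :
    (∀ σ : BigAction.groupG p k n,
      σ ∈ Subgroup.center (BigAction.groupG p k n) ↔
        σ.1 (BigAction.funX p k n) = BigAction.funX p k n ∧
        ∀ j : Fin n, (j : ℕ) + 1 ≤ n - 1 →
          σ.1 (BigAction.funW p k n j) = BigAction.funW p k n j) ∧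
    Nonempty (Subgroup.center (BigAction.groupG p k n) ≃* Multiplicative (ZMod p)) := by
  refine ⟨fun σ => ?_, ⟨mulEquivOfPrimeCardEq (p := p) (BigAction.card_center hp hn hnp) ?_⟩⟩
  · rw [BigAction.mem_center_iff hp hn hnp]
    have hiff : σ.1 (BigAction.funX p k n) = BigAction.funX p k n → ∀ j : Fin n,
        (σ.1 (BigAction.genW p k n (j + 1)) = BigAction.genW p k n (j + 1) ↔
          σ.1 (BigAction.funW p k n j) = BigAction.funW p k n j) := fun h j => by
      rw [BigAction.genW_succ, map_add, ← Polynomial.aeval_algHom_apply, h, add_left_inj]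
    constructor
    · intro h
      exact ⟨h 0 hn, fun j hj => (hiff (h 0 hn) j).mp (h _ (by omega))⟩
    · rintro ⟨h0, h⟩ (_ | j) hj
      · exact h0
      · exact (hiff h0 ⟨j, by omega⟩).mpr (h ⟨j, by omega⟩ (by simp; omega))
  · rw [Nat.card_congr Multiplicative.toAdd, Nat.card_zmod]
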